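/- Let $\mathbb{K}$ be $\mathbb{R}$ or $\mathbb{C}$. For Banach spaces $X_1,\dots,X_n$ ($n\ge 1$) over $\mathbb{K}$ let $\Sigma_{X_1,\dots,X_n}=\{x^1\otimes\cdots\otimes x^n : x^i\in X_i\}$ be the set of decomposable tensors in the algebraic tensor product $X_1\otimes\cdots\otimes X_n$. A \emph{reasonable crossnorm} on $X_1\otimes\cdots\otimes X_n$ is a norm $\beta$ with $\varepsilon\le\beta\le\pi$, where $\varepsilon$ and $\pi$ are the injective and the projective tensor norms. For subspaces $E_i\subset X_i$, the restriction $\beta|$ of $\beta$ to $E_1\otimes\cdots\otimes E_n$ is again a reasonable crossnorm. For a multilinear map $T$ on $X_1\times\cdots\times X_n$ let $\widetilde T$ denote its linearization on $X_1\otimes\cdots\otimes X_n$. A \emph{$\Sigma$-tensor norm on spaces} $\alpha$ assigns to every $n\ge1$, all Banach spaces $X_1,\dots,X_n,Y$ and every reasonable crossnorm $\beta$ on $X_1\otimes\cdots\otimes X_n$ a norm $\alpha^\beta=\alpha^\beta(\,\cdot\,;X_1,\dots,X_n,Y)$ on the algebraic tensor product $X_1\otimes\cdots\otimes X_n\otimes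 Y$ such that (S1) $\alpha^\beta((p-q)\otimes y)\le\beta(p-q)\,\|y\|$ for all $p,q\in\Sigma_{X_1,\dots,X_n}$ and $y\in Y$; (S2) for every multilinear form $\varphi$ on $X_1\times\cdots\times X_n$ whose linearization $\widetilde\varphi$ is $\beta$-bounded, with norm $\|\varphi\|_\beta$, and every $y^*\in Y^*$, the functional $\varphi\otimes y^*: x^1\otimes\cdots\otimes x^n\otimes y\mapsto\varphi(x^1,\dots,x^n)\,y^*(y)$ is $\alpha^\beta$-bounded with norm at most $\|\varphi\|_\beta\|y^*\|$; (S3) for all Banach spaces $Z_1,\dots,Z_m,W$ ($m\ge1$), every reasonable crossnorm $\theta$ on $Z_1\otimes\cdots\otimes Z_m$, every multilinear map $R:Z_1\times\cdots\times Z_m\to X_1\otimes\cdots\otimes X_n$ with values in $\Sigma_{X_1,\dots,X_n}$ whose linearization $\widetilde R:(Z_1\otimes\cdots\otimes Z_m,\theta)\to(X_1\otimes\cdots\otimes X_n,\beta)$ is bounded, and every bounded linear operator $S:W\to Y$, the operator $\widetilde R\otimes S:(Z_1\otimes\cdots\otimes Z_m\otimes W,\alpha^\theta)\to(X_1\otimes\cdots\otimes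 X_n\otimes Y,\alpha^\beta)$ is bounded with $\|\widetilde R\otimes S\|\le\|\widetilde R\|\,\|S\|$. It is \emph{finitely generated} if always $\alpha^\beta(u;X_1,\dots,X_n,Y)=\inf\alpha^{\beta|}(u;E_1,\dots,E_n,F)$, the infimum being taken over all finite dimensional subspaces $E_i\subset X_i$ and $F\subset Y$ such that $u\in E_1\otimes\cdots\otimes E_n\otimes F$. A linear functional $\varphi$ on $X_1\otimes\cdots\otimes X_n\otimes Y$ that is bounded for the projective norm has an associated bounded multilinear operator $T_\varphi:X_1\times\cdots\times X_n\to Y^*$, $\langle T_\varphi(x^1,\dots,x^n),y\rangle=\varphi(x^1\otimes\cdots\otimes x^n\otimes y)$, and its \emph{canonical extension} $\overline\varphi$ is the linear functional on $X_1\otimes\cdots\otimes X_n\otimes Y^{**}$ with $\overline\varphi(x^1\otimes\cdots\otimes x^n\otimes y^{**})=\langle y^{**},T_\varphi(x^1,\dots,x^n)\rangle$. \textbf{Proposition.} Let $\alpha$ be a finitely generated $\Sigma$-tensor norm on spaces, let $X_1,\dots,X_n,Y$ ($n\ge1$) be Banach spaces and let $\beta$ be a reasonable crossnorm on $X_1\otimes\cdots\otimes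 X_n$. Then: (i) $(X_1\otimes\cdots\otimes X_n\otimes Y,\alpha^\beta)$ is a closed subspace of $(X_1\otimes\cdots\otimes X_n\otimes Y^{**},\alpha^\beta)$: the linear map $I\otimes K_Y$ induced by the canonical embedding $K_Y:Y\to Y^{**}$ is isometric and has closed range. (ii) A linear functional $\varphi$ on $X_1\otimes\cdots\otimes X_n\otimes Y$ is $\alpha^\beta$-bounded if and only if it is bounded for the projective norm (so that $\overline\varphi$ is defined) and $\overline\varphi$ is $\alpha^\beta$-bounded on $X_1\otimes\cdots\otimes X_n\otimes Y^{**}$. In this situation $\|\varphi\|=\|\overline\varphi\|$. -/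

import Mathlib

open scoped TensorProduct Topology

universe u v w

noncomputable section

namespace SigmaTensor

/-! ### Bounded linear maps between spaces carrying explicitly given norms -/

section Bounded

variable {𝕜 : Type} [RCLike 𝕜] {V : Type v} [AddCommGroup V] [Module 𝕜 V]
  {W : Type w} [AddCommGroup W] [Module 𝕜 W]

/-- The linear map `T` is bounded from `(V, p)` to `(W, q)`. -/
def IsBdd (p : V → ℝ) (q : W → ℝ) (T : V →ₗ[𝕜] W) : Prop :=
  ∃ C : ℝ, ∀ v, q (T v) ≤ C * p v

/-- The operator norm of `T : (V, p) → (W, q)`, the least `C ≥ 0` with `q (T v) ≤ C * p v`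
(meaningful when `T` is bounded). -/
def opNorm (p : V → ℝ) (q : W → ℝ) (T : V →ₗ[𝕜] W) : ℝ :=
  sInf {C : ℝ | 0 ≤ C ∧ ∀ v, q (T v) ≤ C * p v}

/-- The topology of the space `(V, p)`. -/
abbrev normTopology (p : Seminorm 𝕜 V) : TopologicalSpace V :=
  p.toAddGroupSeminorm.toSeminormedAddCommGroup.toUniformSpace.toTopologicalSpace

end Bounded

/-! ### Decomposable tensors and reasonable crossnorms -/

section Crossnorm

variable (𝕜 : Type) [RCLike 𝕜] {n : ℕ} (X : Fin n → Type u)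
  [∀ i, NormedAddCommGroup (X i)] [∀ i, NormedSpace 𝕜 (X i)]

/-- The set `Σ` of decomposable tensors of `X₁ ⊗ ⋯ ⊗ Xₙ`. -/
def decomposable : Set (⨂[𝕜] i, X i) :=
  {p | ∃ x : ∀ i, X i, p = ⨂ₜ[𝕜] i, x i}

variable {𝕜 X}

/-- The functional `x₁* ⊗ ⋯ ⊗ xₙ*` on `X₁ ⊗ ⋯ ⊗ Xₙ`, which maps `x₁ ⊗ ⋯ ⊗ xₙ` to
`x₁*(x₁) ⋯ xₙ*(xₙ)`. -/
def dualTensor (f : ∀ i, StrongDual 𝕜 (X i)) : (⨂[𝕜] i, X i) →ₗ[𝕜] 𝕜 :=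
  PiTensorProduct.lift
    ((MultilinearMap.mkPiAlgebra 𝕜 (Fin n) 𝕜).compLinearMap fun i => (f i).toLinearMap)

theorem dualTensor_tprod (f : ∀ i, StrongDual 𝕜 (X i)) (x : ∀ i, X i) :
    dualTensor f (⨂ₜ[𝕜] i, x i) = ∏ i, f i (x i) := by
  simp [dualTensor]

/-- The injective norm `ε` on `X₁ ⊗ ⋯ ⊗ Xₙ`. -/
def injectiveNorm (u : ⨂[𝕜] i, X i) : ℝ :=
  sSup {r : ℝ | ∃ f : ∀ i, StrongDual 𝕜 (X i), (∀ i, ‖f i‖ ≤ 1) ∧ r = ‖dualTensor f u‖}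

theorem norm_dualTensor_le (f : ∀ i, StrongDual 𝕜 (X i)) (hf : ∀ i, ‖f i‖ ≤ 1)
    (u : ⨂[𝕜] i, X i) : ‖dualTensor f u‖ ≤ PiTensorProduct.projectiveSeminorm u := by
  let g : ContinuousMultilinearMap 𝕜 X 𝕜 :=
    ((MultilinearMap.mkPiAlgebra 𝕜 (Fin n) 𝕜).compLinearMap
      fun i => (f i).toLinearMap).mkContinuous 1 (by
        intro x
        simp only [MultilinearMap.compLinearMap_apply, MultilinearMap.mkPiAlgebra_apply, one_mul,
          norm_prod]
        refine Finset.prod_le_prod (fun i _ => norm_nonneg _) fun i _ => ?_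
        exact (f i).le_of_opNorm_le_of_le (hf i) le_rfl |>.trans (by simp))
  have hg : ‖g‖ ≤ 1 := MultilinearMap.mkContinuous_norm_le _ zero_le_one _
  have h := PiTensorProduct.norm_eval_le_projectiveSeminorm g u
  exact h.trans (mul_le_of_le_one_left (norm_nonneg u) hg)

theorem norm_dualTensor_le_injectiveNorm (f : ∀ i, StrongDual 𝕜 (X i)) (hf : ∀ i, ‖f i‖ ≤ 1)
    (u : ⨂[𝕜] i, X i) : ‖dualTensor f u‖ ≤ injectiveNorm u := by
  refine le_csSup ⟨PiTensorProduct.projectiveSeminorm u, ?_⟩ ⟨f, hf, rfl⟩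
  rintro _ ⟨g, hg, rfl⟩
  exact norm_dualTensor_le g hg u

variable (𝕜 X)

/-- A reasonable crossnorm on `X₁ ⊗ ⋯ ⊗ Xₙ`: a norm `β` with `ε ≤ β ≤ π`.
(`PiTensorProduct.projectiveSeminorm` is the projective norm `π`.) -/
structure ReasonableCrossnorm where
  toSeminorm : Seminorm 𝕜 (⨂[𝕜] i, X i)
  eq_zero_of_apply_eq_zero : ∀ u, toSeminorm u = 0 → u = 0
  injectiveNorm_le : ∀ u, injectiveNorm u ≤ toSeminorm u
  le_projectiveNorm : ∀ u, toSeminorm u ≤ PiTensorProduct.projectiveSeminorm u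

variable {𝕜 X}

instance : CoeFun (ReasonableCrossnorm 𝕜 X) (fun _ => (⨂[𝕜] i, X i) → ℝ) :=
  ⟨fun β => β.toSeminorm⟩

/-- The inclusion of `E₁ ⊗ ⋯ ⊗ Eₙ` into `X₁ ⊗ ⋯ ⊗ Xₙ`, for subspaces `Eᵢ ⊆ Xᵢ`. -/
def inclusion (E : ∀ i, Submodule 𝕜 (X i)) : (⨂[𝕜] i, E i) →ₗ[𝕜] ⨂[𝕜] i, X i :=
  PiTensorProduct.map fun i => (E i).subtype

theorem inclusion_injective (E : ∀ i, Submodule 𝕜 (X i)) :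
    Function.Injective (inclusion E) := by
  choose g hg using fun i => (E i).subtype.exists_leftInverse_of_injective (E i).ker_subtype
  have h : (PiTensorProduct.map g) ∘ₗ inclusion E = LinearMap.id := by
    rw [inclusion, ← PiTensorProduct.map_comp]
    simp only [hg]
    exact PiTensorProduct.map_id
  intro a b hab
  have := congrArg (PiTensorProduct.map g) hab
  simpa [← LinearMap.comp_apply, h] using this

theorem projectiveSeminorm_inclusion_le (E : ∀ i, Submodule 𝕜 (X i)) (u : ⨂[𝕜] i, E i) :
    PiTensorProduct.projectiveSeminorm (inclusion E u) ≤
      PiTensorProduct.projectiveSeminorm u := by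
  let g : ContinuousMultilinearMap 𝕜 (fun i => E i) (⨂[𝕜] i, X i) :=
    ((PiTensorProduct.tprod 𝕜).compLinearMap fun i => (E i).subtype).mkContinuous 1 (by
        intro x
        simpa using PiTensorProduct.projectiveSeminorm_tprod_le (𝕜 := 𝕜) fun i => (x i : X i))
  have hg : ‖g‖ ≤ 1 := MultilinearMap.mkContinuous_norm_le _ zero_le_one _
  have h := PiTensorProduct.norm_eval_le_projectiveSeminorm g u
  exact h.trans (mul_le_of_le_one_left (norm_nonneg u) hg)

/-- The restriction `β|` of a reasonable crossnorm to `E₁ ⊗ ⋯ ⊗ Eₙ`. -/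
def ReasonableCrossnorm.restrict (β : ReasonableCrossnorm 𝕜 X) (E : ∀ i, Submodule 𝕜 (X i)) :
    ReasonableCrossnorm 𝕜 (fun i => E i) where
  toSeminorm := β.toSeminorm.comp (inclusion E)
  eq_zero_of_apply_eq_zero u hu :=
    inclusion_injective E ((β.eq_zero_of_apply_eq_zero _ hu).trans (map_zero _).symm)
  injectiveNorm_le u := by
    refine Real.sSup_le ?_ (apply_nonneg _ _)
    rintro _ ⟨f, hf, rfl⟩
    choose g hg hgn using fun i => exists_extension_norm_eq (E i) (f i)
    have h : dualTensor f = dualTensor g ∘ₗ inclusion E := by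
      ext x
      simp [dualTensor, inclusion, hg]
    rw [h]
    exact (norm_dualTensor_le_injectiveNorm g (fun i => (hgn i).trans_le (hf i)) _).trans
      (β.injectiveNorm_le _)
  le_projectiveNorm u :=
    (β.le_projectiveNorm _).trans (projectiveSeminorm_inclusion_le E u)

end Crossnorm

/-! ### `Σ`-tensor norms on spaces -/

section SigmaOperator

variable {𝕜 : Type} [RCLike 𝕜] {n m : ℕ} {X : Fin n → Type u}
  [∀ i, NormedAddCommGroup (X i)] [∀ i, NormedSpace 𝕜 (X i)]
  {Z : Fin m → Type u} [∀ i, NormedAddCommGroup (Z i)] [∀ i, NormedSpace 𝕜 (Z i)]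

/-- The multilinear map `R : Z₁ × ⋯ × Zₘ → X₁ ⊗ ⋯ ⊗ Xₙ` has values in the decomposable tensors
and its linearization `(Z₁ ⊗ ⋯ ⊗ Zₘ, θ) → (X₁ ⊗ ⋯ ⊗ Xₙ, β)` is bounded, that is, `R` defines a
`Σ`-`β`-`θ`-operator. (As `θ ≤ π`, such an `R` is a bounded multilinear map.) -/
def IsSigmaOperator (β : ReasonableCrossnorm 𝕜 X) (θ : ReasonableCrossnorm 𝕜 Z)
    (R : MultilinearMap 𝕜 Z (⨂[𝕜] i, X i)) : Prop :=
  (∀ z, R z ∈ decomposable 𝕜 X) ∧ IsBdd θ β (PiTensorProduct.lift R)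

end SigmaOperator

/-- A `Σ`-tensor norm on spaces on the class of all Banach spaces over `𝕜`: to every `n ≥ 1`,
Banach spaces `X₁, …, Xₙ, Y` and reasonable crossnorm `β` on `X₁ ⊗ ⋯ ⊗ Xₙ` it assigns a norm
`α^β` on the algebraic tensor product `X₁ ⊗ ⋯ ⊗ Xₙ ⊗ Y` with the properties S1, S2, S3. -/
structure SigmaTensorNorm (𝕜 : Type) [RCLike 𝕜] where
  norm {n : ℕ} [NeZero n] (X : Fin n → Type u) [∀ i, NormedAddCommGroup (X i)]
    [∀ i, NormedSpace 𝕜 (X i)] [∀ i, CompleteSpace (X i)]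
    (Y : Type u) [NormedAddCommGroup Y] [NormedSpace 𝕜 Y] [CompleteSpace Y]
    (β : ReasonableCrossnorm 𝕜 X) : Seminorm 𝕜 ((⨂[𝕜] i, X i) ⊗[𝕜] Y)
  eq_zero_of_norm_eq_zero {n : ℕ} [NeZero n] (X : Fin n → Type u)
    [∀ i, NormedAddCommGroup (X i)] [∀ i, NormedSpace 𝕜 (X i)] [∀ i, CompleteSpace (X i)]
    (Y : Type u) [NormedAddCommGroup Y] [NormedSpace 𝕜 Y] [CompleteSpace Y]
    (β : ReasonableCrossnorm 𝕜 X) (u : (⨂[𝕜] i, X i) ⊗[𝕜] Y) (hu : norm X Y β u = 0) : u = 0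
  /-- S1 -/
  norm_sub_tmul_le {n : ℕ} [NeZero n] (X : Fin n → Type u)
    [∀ i, NormedAddCommGroup (X i)] [∀ i, NormedSpace 𝕜 (X i)] [∀ i, CompleteSpace (X i)]
    (Y : Type u) [NormedAddCommGroup Y] [NormedSpace 𝕜 Y] [CompleteSpace Y]
    (β : ReasonableCrossnorm 𝕜 X) (p q : ⨂[𝕜] i, X i) (hp : p ∈ decomposable 𝕜 X)
    (hq : q ∈ decomposable 𝕜 X) (y : Y) :
    norm X Y β ((p - q) ⊗ₜ[𝕜] y) ≤ β (p - q) * ‖y‖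
  /-- S2 -/
  functional_bound {n : ℕ} [NeZero n] (X : Fin n → Type u)
    [∀ i, NormedAddCommGroup (X i)] [∀ i, NormedSpace 𝕜 (X i)] [∀ i, CompleteSpace (X i)]
    (Y : Type u) [NormedAddCommGroup Y] [NormedSpace 𝕜 Y] [CompleteSpace Y]
    (β : ReasonableCrossnorm 𝕜 X) (φ : MultilinearMap 𝕜 X 𝕜)
    (hφ : IsBdd β (fun c : 𝕜 => ‖c‖) (PiTensorProduct.lift φ)) (f : StrongDual 𝕜 Y) :
    let φf : (⨂[𝕜] i, X i) ⊗[𝕜] Y →ₗ[𝕜] 𝕜 :=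
      LinearMap.mul' 𝕜 𝕜 ∘ₗ TensorProduct.map (PiTensorProduct.lift φ) f.toLinearMap
    IsBdd (norm X Y β) (fun c : 𝕜 => ‖c‖) φf ∧
      opNorm (norm X Y β) (fun c : 𝕜 => ‖c‖) φf ≤
        opNorm β (fun c : 𝕜 => ‖c‖) (PiTensorProduct.lift φ) * ‖f‖
  /-- S3 -/
  map_bound {n m : ℕ} [NeZero n] [NeZero m] (X : Fin n → Type u)
    [∀ i, NormedAddCommGroup (X i)] [∀ i, NormedSpace 𝕜 (X i)] [∀ i, CompleteSpace (X i)]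
    (Y : Type u) [NormedAddCommGroup Y] [NormedSpace 𝕜 Y] [CompleteSpace Y]
    (β : ReasonableCrossnorm 𝕜 X) (Z : Fin m → Type u)
    [∀ i, NormedAddCommGroup (Z i)] [∀ i, NormedSpace 𝕜 (Z i)] [∀ i, CompleteSpace (Z i)]
    (W : Type u) [NormedAddCommGroup W] [NormedSpace 𝕜 W] [CompleteSpace W]
    (θ : ReasonableCrossnorm 𝕜 Z) (R : MultilinearMap 𝕜 Z (⨂[𝕜] i, X i))
    (hR : IsSigmaOperator β θ R) (S : W →L[𝕜] Y) :
    let RS : (⨂[𝕜] i, Z i) ⊗[𝕜] W →ₗ[𝕜] (⨂[𝕜] i, X i) ⊗[𝕜] Y :=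
      TensorProduct.map (PiTensorProduct.lift R) S.toLinearMap
    IsBdd (norm Z W θ) (norm X Y β) RS ∧
      opNorm (norm Z W θ) (norm X Y β) RS ≤ opNorm θ β (PiTensorProduct.lift R) * ‖S‖

namespace SigmaTensorNorm

variable {𝕜 : Type} [RCLike 𝕜]

/-- The norm `α^{β|}` on `E₁ ⊗ ⋯ ⊗ Eₙ ⊗ F` for finite dimensional subspaces `Eᵢ ⊆ Xᵢ`,
`F ⊆ Y`. -/
def restrictNorm (α : SigmaTensorNorm.{u} 𝕜) {n : ℕ} [NeZero n] {X : Fin n → Type u}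
    [∀ i, NormedAddCommGroup (X i)] [∀ i, NormedSpace 𝕜 (X i)]
    {Y : Type u} [NormedAddCommGroup Y] [NormedSpace 𝕜 Y]
    (β : ReasonableCrossnorm 𝕜 X) (E : ∀ i, Submodule 𝕜 (X i)) (F : Submodule 𝕜 Y)
    [∀ i, FiniteDimensional 𝕜 (E i)] [FiniteDimensional 𝕜 F] :
    Seminorm 𝕜 ((⨂[𝕜] i, E i) ⊗[𝕜] F) :=
  haveI : ∀ i, CompleteSpace (E i) := fun i => FiniteDimensional.complete 𝕜 (E i)
  haveI : CompleteSpace F := FiniteDimensional.complete 𝕜 F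
  α.norm (fun i => E i) F (β.restrict E)

/-- `α` is finitely generated: `α^β(u; X₁, …, Xₙ, Y)` is the infimum of the numbers
`α^{β|}(u; E₁, …, Eₙ, F)` over all finite dimensional subspaces `Eᵢ ⊆ Xᵢ`, `F ⊆ Y` such that
`u` lies in `E₁ ⊗ ⋯ ⊗ Eₙ ⊗ F`. -/
def FinitelyGenerated (α : SigmaTensorNorm.{u} 𝕜) : Prop :=
  ∀ {n : ℕ} [NeZero n] (X : Fin n → Type u) [∀ i, NormedAddCommGroup (X i)]
    [∀ i, NormedSpace 𝕜 (X i)] [∀ i, CompleteSpace (X i)]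
    (Y : Type u) [NormedAddCommGroup Y] [NormedSpace 𝕜 Y] [CompleteSpace Y]
    (β : ReasonableCrossnorm 𝕜 X) (u : (⨂[𝕜] i, X i) ⊗[𝕜] Y),
    IsGLB {r : ℝ | ∃ (E : ∀ i, Submodule 𝕜 (X i)) (F : Submodule 𝕜 Y)
        (_ : ∀ i, FiniteDimensional 𝕜 (E i)) (_ : FiniteDimensional 𝕜 F)
        (v : (⨂[𝕜] i, E i) ⊗[𝕜] F),
        TensorProduct.map (inclusion E) F.subtype v = u ∧ r = α.restrictNorm β E F v}
      (α.norm X Y β u)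

end SigmaTensorNorm

/-! ### The canonical extension of a functional -/

section Extension

variable {𝕜 : Type} [RCLike 𝕜] {n : ℕ} {X : Fin n → Type u}
  [∀ i, NormedAddCommGroup (X i)] [∀ i, NormedSpace 𝕜 (X i)]
  {Y : Type u} [NormedAddCommGroup Y] [NormedSpace 𝕜 Y]

/-- The set of the numbers `∑ⱼ ‖xⱼ¹‖ ⋯ ‖xⱼⁿ‖ ‖yⱼ‖` over all the representations
`u = ∑ⱼ xⱼ¹ ⊗ ⋯ ⊗ xⱼⁿ ⊗ yⱼ`. -/
def projectiveSums (u : (⨂[𝕜] i, X i) ⊗[𝕜] Y) : Set ℝ :=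
  {r | ∃ (k : ℕ) (x : Fin k → ∀ i, X i) (y : Fin k → Y),
    u = ∑ j, (⨂ₜ[𝕜] i, x j i) ⊗ₜ[𝕜] y j ∧ r = ∑ j, (∏ i, ‖x j i‖) * ‖y j‖}

/-- The projective norm on `X₁ ⊗ ⋯ ⊗ Xₙ ⊗ Y`. -/
def projectiveNorm (u : (⨂[𝕜] i, X i) ⊗[𝕜] Y) : ℝ := sInf (projectiveSums u)

theorem projectiveNorm_nonneg (u : (⨂[𝕜] i, X i) ⊗[𝕜] Y) : 0 ≤ projectiveNorm u := by
  refine Real.sInf_nonneg ?_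
  rintro _ ⟨k, x, y, -, rfl⟩
  positivity

theorem projectiveNorm_tmul_le (x : ∀ i, X i) (y : Y) :
    projectiveNorm ((⨂ₜ[𝕜] i, x i) ⊗ₜ[𝕜] y) ≤ (∏ i, ‖x i‖) * ‖y‖ := by
  refine csInf_le ⟨0, ?_⟩ ⟨1, fun _ => x, fun _ => y, by simp, by simp⟩
  rintro _ ⟨k, x, y, -, rfl⟩
  positivity

/-- `φ` is a bounded functional on `X₁ ⊗_π ⋯ ⊗_π Xₙ ⊗_π Y`. -/
def IsProjectivelyBdd (φ : (⨂[𝕜] i, X i) ⊗[𝕜] Y →ₗ[𝕜] 𝕜) : Prop :=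
  IsBdd projectiveNorm (fun c : 𝕜 => ‖c‖) φ

theorem IsProjectivelyBdd.exists_bound {φ : (⨂[𝕜] i, X i) ⊗[𝕜] Y →ₗ[𝕜] 𝕜}
    (h : IsProjectivelyBdd φ) : ∃ C : ℝ, 0 ≤ C ∧ ∀ (x : ∀ i, X i) (y : Y),
      ‖φ ((⨂ₜ[𝕜] i, x i) ⊗ₜ[𝕜] y)‖ ≤ (C * ∏ i, ‖x i‖) * ‖y‖ := by
  obtain ⟨C, hC⟩ := h
  refine ⟨|C|, abs_nonneg C, fun x y => ?_⟩
  rw [mul_assoc]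
  calc _ ≤ C * projectiveNorm ((⨂ₜ[𝕜] i, x i) ⊗ₜ[𝕜] y) := hC _
    _ ≤ |C| * projectiveNorm ((⨂ₜ[𝕜] i, x i) ⊗ₜ[𝕜] y) :=
      mul_le_mul_of_nonneg_right (le_abs_self C) (projectiveNorm_nonneg _)
    _ ≤ _ := mul_le_mul_of_nonneg_left (projectiveNorm_tmul_le x y) (abs_nonneg C)

/-- The bounded functional `y ↦ φ(x₁ ⊗ ⋯ ⊗ xₙ ⊗ y)` on `Y`. -/
def slice (φ : (⨂[𝕜] i, X i) ⊗[𝕜] Y →ₗ[𝕜] 𝕜) (h : IsProjectivelyBdd φ) (x : ∀ i, X i) :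
    StrongDual 𝕜 Y :=
  LinearMap.mkContinuous (TensorProduct.curry φ (⨂ₜ[𝕜] i, x i))
    (h.exists_bound.choose * ∏ i, ‖x i‖) (h.exists_bound.choose_spec.2 x)

theorem slice_apply (φ : (⨂[𝕜] i, X i) ⊗[𝕜] Y →ₗ[𝕜] 𝕜) (h : IsProjectivelyBdd φ)
    (x : ∀ i, X i) (y : Y) : slice φ h x y = φ ((⨂ₜ[𝕜] i, x i) ⊗ₜ[𝕜] y) :=
  LinearMap.mkContinuous_apply _ _ (h.exists_bound.choose_spec.2 x) y

/-- The bounded multilinear operator `T_φ : X₁ × ⋯ × Xₙ → Y*` defined by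
`⟨T_φ(x₁, …, xₙ), y⟩ = φ(x₁ ⊗ ⋯ ⊗ xₙ ⊗ y)`. -/
def associatedOperator (φ : (⨂[𝕜] i, X i) ⊗[𝕜] Y →ₗ[𝕜] 𝕜) (h : IsProjectivelyBdd φ) :
    ContinuousMultilinearMap 𝕜 X (StrongDual 𝕜 Y) :=
  MultilinearMap.mkContinuous
    { toFun := slice φ h
      map_update_add' := fun x i a b => by
        ext y
        simp [slice_apply, MultilinearMap.map_update_add, TensorProduct.add_tmul]
      map_update_smul' := fun x i c a => by
        ext y
        simp [slice_apply, MultilinearMap.map_update_smul, ← TensorProduct.smul_tmul'] }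
    h.exists_bound.choose (fun x => LinearMap.mkContinuous_norm_le _
      (mul_nonneg h.exists_bound.choose_spec.1 (Finset.prod_nonneg fun _ _ => norm_nonneg _))
      (h.exists_bound.choose_spec.2 x))

theorem associatedOperator_apply (φ : (⨂[𝕜] i, X i) ⊗[𝕜] Y →ₗ[𝕜] 𝕜) (h : IsProjectivelyBdd φ)
    (x : ∀ i, X i) (y : Y) :
    associatedOperator φ h x y = φ ((⨂ₜ[𝕜] i, x i) ⊗ₜ[𝕜] y) :=
  slice_apply φ h x y

/-- The canonical extension `φ̄ : X₁ ⊗ ⋯ ⊗ Xₙ ⊗ Y** → 𝕜` of `φ`, the linear functional with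
`φ̄(x₁ ⊗ ⋯ ⊗ xₙ ⊗ y**) = ⟨y**, T_φ(x₁, …, xₙ)⟩`. -/
def canonicalExtension (φ : (⨂[𝕜] i, X i) ⊗[𝕜] Y →ₗ[𝕜] 𝕜) (h : IsProjectivelyBdd φ) :
    (⨂[𝕜] i, X i) ⊗[𝕜] StrongDual 𝕜 (StrongDual 𝕜 Y) →ₗ[𝕜] 𝕜 :=
  TensorProduct.lift
    ((ContinuousLinearMap.coeLM (M := StrongDual 𝕜 Y) (N₃ := 𝕜) 𝕜).flip ∘ₗ
      PiTensorProduct.lift (associatedOperator φ h).toMultilinearMap)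

theorem canonicalExtension_tmul (φ : (⨂[𝕜] i, X i) ⊗[𝕜] Y →ₗ[𝕜] 𝕜) (h : IsProjectivelyBdd φ)
    (x : ∀ i, X i) (g : StrongDual 𝕜 (StrongDual 𝕜 Y)) :
    canonicalExtension φ h ((⨂ₜ[𝕜] i, x i) ⊗ₜ[𝕜] g) = g (associatedOperator φ h x) := by
  simp [canonicalExtension]

variable (𝕜 X Y)

/-- The inclusion `I ⊗ K_Y` of `X₁ ⊗ ⋯ ⊗ Xₙ ⊗ Y` into `X₁ ⊗ ⋯ ⊗ Xₙ ⊗ Y**`, where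
`K_Y : Y → Y**` is the canonical embedding. -/
def bidualInclusion :
    (⨂[𝕜] i, X i) ⊗[𝕜] Y →ₗ[𝕜] (⨂[𝕜] i, X i) ⊗[𝕜] StrongDual 𝕜 (StrongDual 𝕜 Y) :=
  TensorProduct.map LinearMap.id (NormedSpace.inclusionInDoubleDual 𝕜 Y).toLinearMap

end Extension

end SigmaTensor

end

/-!
The heart of the matter is a weak form of local reflexivity. For a finite dimensional space `F`,
choose a finite `δ`-net `t` of the unit ball of `F`. Evaluation on `t` embeds `L(F, Y)` into
`ℓ_∞(t, Y)` up to the factor `1 - δ`, so by Hahn–Banach a functional `S ↦ ∑ⱼ ⟨yⱼ, S xⱼ⟩` on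
`L(F, Y)` equals `S ↦ ∑ z ∈ t, ⟨f_z, S z⟩` with `∑ ‖f_z‖` as close to its norm as we like. The
second expression bounds the extension `T ↦ ∑ⱼ ⟨T xⱼ, yⱼ⟩` to `L(F, Y**)` by the same norm.

If `u` in `X₁ ⊗ ⋯ ⊗ Xₙ ⊗ Y**` comes from `v` in `E₁ ⊗ ⋯ ⊗ Eₙ ⊗ F` with `F ⊆ Y**` finite
dimensional, then `S ↦ φ ((I ⊗ S) v)` is such a functional on `L(F, Y)`, of norm at most
`‖φ‖ α^{β|}(v)` by S3, and its extension takes the value `φ̄ u` at the inclusion of `F`. As `α` is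
finitely generated, `‖φ̄‖ ≤ ‖φ‖`. Applied to a functional which norms `u`, this shows that `I ⊗ K_Y`
is isometric. Its range is the kernel of `I ⊗ Q`, where `Q : Y** → Y** / K_Y(Y)` is the quotient
map, and `I ⊗ Q` is continuous by S3.
-/

namespace SigmaTensor

-- Needed to find the operator norm on `F →L[𝕜] StrongDual 𝕜 (StrongDual 𝕜 Y)`.
set_option maxSynthPendingDepth 3

section Bounded

variable {𝕜 : Type} [RCLike 𝕜] {V : Type v} [AddCommGroup V] [Module 𝕜 V]
  {W : Type w} [AddCommGroup W] [Module 𝕜 W]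

theorem IsBdd.exists_nonneg {p : V → ℝ} {q : W → ℝ} {T : V →ₗ[𝕜] W} (hp : ∀ v, 0 ≤ p v)
    (h : IsBdd p q T) : ∃ C, 0 ≤ C ∧ ∀ v, q (T v) ≤ C * p v := by
  obtain ⟨C, hC⟩ := h
  exact ⟨|C|, abs_nonneg C, fun v =>
    (hC v).trans (mul_le_mul_of_nonneg_right (le_abs_self C) (hp v))⟩

theorem opNorm_le {p : V → ℝ} {q : W → ℝ} {T : V →ₗ[𝕜] W} {C : ℝ} (hC : 0 ≤ C)
    (h : ∀ v, q (T v) ≤ C * p v) : opNorm p q T ≤ C :=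
  csInf_le ⟨0, fun _ h => h.1⟩ ⟨hC, h⟩

theorem IsBdd.le_opNorm {p : V → ℝ} {q : W → ℝ} {T : V →ₗ[𝕜] W} (hp : ∀ v, 0 ≤ p v)
    (h : IsBdd p q T) (v : V) : q (T v) ≤ opNorm p q T * p v := by
  obtain ⟨C, hC, hCT⟩ := h.exists_nonneg hp
  rcases (hp v).eq_or_lt with hv | hv
  · simpa [← hv] using hCT v
  · rw [← div_le_iff₀ hv]
    exact le_csInf ⟨C, hC, hCT⟩ fun D hD => (div_le_iff₀ hv).2 (hD.2 v)

theorem isClosed_ker_of_isBdd {p : Seminorm 𝕜 V} {q : Seminorm 𝕜 W} {T : V →ₗ[𝕜] W}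
    (hq : ∀ w, q w = 0 → w = 0) (hT : IsBdd p q T) :
    IsClosed[normTopology p] (LinearMap.ker T : Set V) := by
  let := p.toAddGroupSeminorm.toSeminormedAddCommGroup
  let := q.toAddGroupSeminorm.toSeminormedAddCommGroup
  obtain ⟨C, hC⟩ := hT
  have hT_cont : Continuous T := AddMonoidHomClass.continuous_of_bound T C hC
  have hker : (LinearMap.ker T : Set V) = (fun v => ‖T v‖) ⁻¹' {0} :=
    Set.ext fun v => ⟨fun hv => (congrArg q hv).trans (map_zero q), hq (T v)⟩
  rw [hker]
  exact isClosed_singleton.preimage hT_cont.norm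

theorem exists_functional_apply_eq (p : Seminorm 𝕜 V) (v : V) :
    ∃ g : V →ₗ[𝕜] 𝕜, (∀ w, ‖g w‖ ≤ p w) ∧ ‖g v‖ = p v := by
  let : SeminormedAddCommGroup V := p.toAddGroupSeminorm.toSeminormedAddCommGroup
  let : NormedSpace 𝕜 V := ⟨fun c w => (map_smul_eq_mul p c w).le⟩
  obtain ⟨g, hg, hgv⟩ := exists_dual_vector'' 𝕜 v
  exact ⟨g, fun w => (g.le_of_opNorm_le hg w).trans_eq (one_mul _),
    (congrArg norm hgv).trans (RCLike.norm_of_nonneg (norm_nonneg v))⟩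

end Bounded

section LocalReflexivity

variable {𝕜 : Type*} [RCLike 𝕜]

theorem exists_strongDual_comp_eq_of_norm_le {V W : Type*} [AddCommGroup V] [Module 𝕜 V]
    [SeminormedAddCommGroup W] [NormedSpace 𝕜 W] (J : V →ₗ[𝕜] W) (l : V →ₗ[𝕜] 𝕜) {C : ℝ}
    (hC : 0 ≤ C) (hl : ∀ v, ‖l v‖ ≤ C * ‖J v‖) :
    ∃ g : StrongDual 𝕜 W, (∀ v, g (J v) = l v) ∧ ‖g‖ ≤ C := by
  have hker : l ∈ (LinearMap.ker J).dualAnnihilator := by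
    refine (Submodule.mem_dualAnnihilator _).2 fun v hv => norm_le_zero_iff.1 ?_
    simpa [LinearMap.mem_ker.1 hv] using hl v
  obtain ⟨g₀, rfl⟩ := (LinearMap.range_dualMap_eq_dualAnnihilator_ker J).ge hker
  have hg₀ : ∀ w : LinearMap.range J, ‖g₀ w‖ ≤ C * ‖w‖ := by
    rintro ⟨_, v, rfl⟩
    exact hl v
  obtain ⟨g, hg, hg_norm⟩ := exists_extension_norm_eq (LinearMap.range J)
    ((g₀.domRestrict (LinearMap.range J)).mkContinuous C hg₀)
  exact ⟨g, fun v => hg ⟨J v, v, rfl⟩,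
    hg_norm.trans_le (LinearMap.mkContinuous_norm_le _ hC _)⟩

section Pi

variable {ι : Type*} [Fintype ι] [DecidableEq ι] {Y : ι → Type*}
  [∀ i, NormedAddCommGroup (Y i)] [∀ i, NormedSpace 𝕜 (Y i)]

theorem sum_norm_apply_single_le (g : StrongDual 𝕜 (∀ i, Y i)) {y : ∀ i, Y i}
    (hy : ∀ i, ‖y i‖ ≤ 1) : ∑ i, ‖g (Pi.single i (y i))‖ ≤ ‖g‖ := by
  choose c hc hcy using fun i => RCLike.exists_norm_eq_mul_self (g (Pi.single i (y i)))
  have hsum : ((∑ i, ‖g (Pi.single i (y i))‖ : ℝ) : 𝕜) = g fun i => c i • y i := by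
    rw [← Finset.univ_sum_single fun i => c i • y i, map_sum, RCLike.ofReal_sum]
    exact Finset.sum_congr rfl fun i _ => by rw [hcy, Pi.single_smul, map_smul, smul_eq_mul]
  have hball : ‖fun i => c i • y i‖ ≤ 1 :=
    (pi_norm_le_iff_of_nonneg zero_le_one).2 fun i => by simpa [norm_smul, hc] using hy i
  rw [← RCLike.norm_of_nonneg (K := 𝕜) (Finset.sum_nonneg fun i _ => norm_nonneg _), hsum]
  exact g.unit_le_opNorm _ hball

theorem sum_norm_comp_single_le (g : StrongDual 𝕜 (∀ i, Y i)) :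
    ∑ i, ‖g ∘L ContinuousLinearMap.single 𝕜 Y i‖ ≤ ‖g‖ := by
  set f := fun i => g ∘L ContinuousLinearMap.single 𝕜 Y i
  have hlim : Filter.Tendsto (fun η : ℝ => ∑ i, (‖f i‖ - η)) (𝓝[>] 0) (𝓝 (∑ i, ‖f i‖)) :=
    tendsto_nhdsWithin_of_tendsto_nhds <|
      Continuous.tendsto' (by fun_prop) _ _ (by simp only [sub_zero])
  refine le_of_tendsto hlim (eventually_mem_nhdsWithin.mono fun η hη => ?_)
  choose y hy hlt using fun i => (f i).exists_lt_apply_of_lt_opNorm (sub_lt_self ‖f i‖ hη)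
  exact (Finset.sum_le_sum fun i _ => (hlt i).le).trans
    (sum_norm_apply_single_le g fun i => (hy i).le)

end Pi

variable {F : Type*} [NormedAddCommGroup F] [NormedSpace 𝕜 F]
  {Y : Type*} [NormedAddCommGroup Y] [NormedSpace 𝕜 Y]

theorem one_sub_mul_opNorm_le_of_closedBall_subset {t : Finset F} {δ : ℝ}
    (ht : Metric.closedBall 0 1 ⊆ ⋃ z ∈ t, Metric.ball z δ) (S : F →L[𝕜] Y) :
    (1 - δ) * ‖S‖ ≤ ‖fun z : t => S z‖ := by
  obtain ⟨z₀, -, hz₀⟩ := Set.mem_iUnion₂.1 (ht (Metric.mem_closedBall_self zero_le_one))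
  have hδ : 0 ≤ δ := (dist_nonneg.trans_lt hz₀).le
  suffices ‖S‖ ≤ ‖fun z : t => S z‖ + ‖S‖ * δ by linarith
  refine S.opNorm_le_of_unit_norm (by positivity) fun x hx => ?_
  obtain ⟨z, hz, hxz⟩ := Set.mem_iUnion₂.1 (ht (mem_closedBall_zero_iff.2 hx.le))
  calc ‖S x‖ = ‖S z + S (x - z)‖ := by rw [← map_add, add_sub_cancel]
    _ ≤ ‖S z‖ + ‖S (x - z)‖ := norm_add_le _ _
    _ ≤ ‖fun z : t => S z‖ + ‖S‖ * δ :=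
      add_le_add (norm_le_pi_norm (fun z : t => S z) ⟨z, hz⟩)
        (S.le_opNorm_of_le (mem_ball_iff_norm.1 hxz).le)

theorem exists_apply_eq_sum_of_norm_lt [FiniteDimensional 𝕜 F]
    (Λ : StrongDual 𝕜 (F →L[𝕜] Y)) {C : ℝ} (hC : ‖Λ‖ < C) :
    ∃ (t : Finset F) (f : t → StrongDual 𝕜 Y), (∀ z ∈ t, ‖z‖ ≤ 1) ∧
      (∀ S, Λ S = ∑ z, f z (S z)) ∧ ∑ z, ‖f z‖ ≤ C := by
  classical
  have hC₀ : 0 < C := (norm_nonneg Λ).trans_lt hC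
  have : ProperSpace F := FiniteDimensional.proper_rclike 𝕜 F
  obtain ⟨t, ht_ball, ht_fin, ht_cover⟩ := finite_cover_balls_of_compact
    (isCompact_closedBall (0 : F) 1) (sub_pos.2 ((div_lt_one hC₀).2 hC))
  lift t to Finset F using ht_fin
  let evalNet : (F →L[𝕜] Y) →L[𝕜] (t → Y) :=
    ContinuousLinearMap.pi fun z => ContinuousLinearMap.apply 𝕜 Y (z : F)
  have hΛ : ∀ S, ‖Λ S‖ ≤ C * ‖evalNet S‖ := fun S =>
    calc ‖Λ S‖ ≤ ‖Λ‖ * ‖S‖ := Λ.le_opNorm S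
      _ = C * ((1 - (1 - ‖Λ‖ / C)) * ‖S‖) := by field_simp; ring
      _ ≤ C * ‖evalNet S‖ := mul_le_mul_of_nonneg_left
        (one_sub_mul_opNorm_le_of_closedBall_subset ht_cover S) hC₀.le
  obtain ⟨g, hg, hgC⟩ :=
    exists_strongDual_comp_eq_of_norm_le evalNet.toLinearMap Λ.toLinearMap hC₀.le hΛ
  refine ⟨t, fun z => g ∘L ContinuousLinearMap.single 𝕜 (fun _ => Y) z,
    fun z hz => mem_closedBall_zero_iff.1 (ht_ball hz), fun S => ?_,
    (sum_norm_comp_single_le g).trans hgC⟩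
  exact (hg S).symm.trans (ContinuousLinearMap.sum_comp_single 𝕜 _ g (evalNet S)).symm

theorem sum_bidual_apply_congr [FiniteDimensional 𝕜 F] {ι κ : Type*} [Fintype ι] [Fintype κ]
    {x : ι → F} {y : ι → StrongDual 𝕜 Y} {z : κ → F} {f : κ → StrongDual 𝕜 Y}
    (h : ∀ S : F →L[𝕜] Y, ∑ i, y i (S (x i)) = ∑ k, f k (S (z k)))
    (T : F →L[𝕜] StrongDual 𝕜 (StrongDual 𝕜 Y)) :
    ∑ i, T (x i) (y i) = ∑ k, T (z k) (f k) := by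
  have hrankOne : ∀ e : StrongDual 𝕜 F, ∑ i, e (x i) • y i = ∑ k, e (z k) • f k := by
    intro e
    ext w
    simpa using h (e.smulRight w)
  let b := Module.finBasis 𝕜 F
  have hT : ∀ (w : F) (l : StrongDual 𝕜 Y),
      T w l = ∑ j, T (b j) ((b.coord j).toContinuousLinearMap w • l) := by
    intro w l
    conv_lhs => rw [← b.sum_repr w, map_sum]
    simp
  simp_rw [hT _ (y _), hT _ (f _)]
  rw [Finset.sum_comm, Finset.sum_comm (s := Finset.univ (α := κ))]
  simp_rw [← map_sum, hrankOne]

theorem norm_sum_bidual_apply_le [FiniteDimensional 𝕜 F] {ι : Type*} [Fintype ι] (x : ι → F)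
    (y : ι → StrongDual 𝕜 Y) {C : ℝ} (hC : 0 ≤ C)
    (h : ∀ S : F →L[𝕜] Y, ‖∑ i, y i (S (x i))‖ ≤ C * ‖S‖)
    (T : F →L[𝕜] StrongDual 𝕜 (StrongDual 𝕜 Y)) : ‖∑ i, T (x i) (y i)‖ ≤ C * ‖T‖ := by
  let Λ : StrongDual 𝕜 (F →L[𝕜] Y) := ∑ i, y i ∘L ContinuousLinearMap.apply 𝕜 Y (x i)
  have hΛ : ∀ S, Λ S = ∑ i, y i (S (x i)) := fun S => by simp [Λ]
  have hΛC : ‖Λ‖ ≤ C := Λ.opNorm_le_bound hC fun S => (hΛ S).symm ▸ h S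
  refine le_mul_of_forall_lt₀ fun D hD M hM => ?_
  obtain ⟨t, f, ht, hf, hfD⟩ := exists_apply_eq_sum_of_norm_lt Λ (hΛC.trans_lt hD)
  calc ‖∑ i, T (x i) (y i)‖ = ‖∑ z : t, T z (f z)‖ := by
        rw [sum_bidual_apply_congr (fun S => (hΛ S).symm.trans (hf S)) T]
    _ ≤ ∑ z : t, ‖f z‖ * M := norm_sum_le_of_le _ fun z _ => by
        rw [mul_comm]
        refine (T z).le_of_opNorm_le ?_ _
        exact (T.le_of_opNorm_le_of_le hM.le (ht z z.2)).trans_eq (mul_one M)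
    _ ≤ D * M := by
        rw [← Finset.sum_mul]
        exact mul_le_mul_of_nonneg_right hfD ((norm_nonneg T).trans hM.le)

end LocalReflexivity

section Tensor

theorem exists_eq_sum_tprod_tmul {R ι : Type*} [CommSemiring R] {M : ι → Type*}
    [∀ i, AddCommMonoid (M i)] [∀ i, Module R (M i)] {N : Type*} [AddCommMonoid N] [Module R N]
    (u : (⨂[R] i, M i) ⊗[R] N) :
    ∃ (k : ℕ) (x : Fin k → ∀ i, M i) (y : Fin k → N), u = ∑ j, (⨂ₜ[R] i, x j i) ⊗ₜ[R] y j := by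
  have hspan : Submodule.span R (Set.image2 (fun p y => p ⊗ₜ[R] y)
      (Set.range (PiTensorProduct.tprod R (s := M))) (Set.univ : Set N)) = ⊤ := by
    rw [← TensorProduct.map₂_mk_top_top_eq_top, ← PiTensorProduct.span_tprod_eq_top,
      ← Submodule.span_univ (R := R) (M := N), Submodule.map₂_span_span]
    rfl
  obtain ⟨k, c, t, rfl⟩ := Submodule.mem_span_set'.1 (hspan.ge (Submodule.mem_top (x := u)))
  choose p hp y _ ht using fun j => (t j).2
  choose x hx using hp
  exact ⟨k, x, fun j => c j • y j, by simp [hx, ← ht]⟩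

variable {𝕜 : Type} [RCLike 𝕜] {n : ℕ} {X : Fin n → Type u}
  [∀ i, NormedAddCommGroup (X i)] [∀ i, NormedSpace 𝕜 (X i)]
  {Y : Type u} [NormedAddCommGroup Y] [NormedSpace 𝕜 Y]

theorem projectiveSums_nonempty (u : (⨂[𝕜] i, X i) ⊗[𝕜] Y) : (projectiveSums u).Nonempty :=
  let ⟨k, x, y, hu⟩ := exists_eq_sum_tprod_tmul u
  ⟨_, k, x, y, hu, rfl⟩

theorem zero_mem_decomposable [NeZero n] : (0 : ⨂[𝕜] i, X i) ∈ decomposable 𝕜 X :=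
  ⟨0, ((PiTensorProduct.tprod 𝕜).map_coord_zero (0 : Fin n) rfl).symm⟩

theorem lift_tprod_compLinearMap_subtype (E : ∀ i, Submodule 𝕜 (X i)) :
    PiTensorProduct.lift ((PiTensorProduct.tprod 𝕜).compLinearMap fun i => (E i).subtype) =
      inclusion E := by
  ext x
  simp [inclusion]

theorem ReasonableCrossnorm.tprod_le (β : ReasonableCrossnorm 𝕜 X) (x : ∀ i, X i) :
    β (⨂ₜ[𝕜] i, x i) ≤ ∏ i, ‖x i‖ :=
  (β.le_projectiveNorm _).trans (PiTensorProduct.projectiveSeminorm_tprod_le x)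

theorem lift_associatedOperator_apply (φ : (⨂[𝕜] i, X i) ⊗[𝕜] Y →ₗ[𝕜] 𝕜)
    (h : IsProjectivelyBdd φ) (p : ⨂[𝕜] i, X i) (y : Y) :
    PiTensorProduct.lift (associatedOperator φ h).toMultilinearMap p y = φ (p ⊗ₜ y) := by
  induction p using PiTensorProduct.induction_on with
  | smul_tprod c x => simp [associatedOperator_apply, ← TensorProduct.smul_tmul']
  | add p q hp hq => simp [hp, hq, TensorProduct.add_tmul]

theorem canonicalExtension_bidualInclusion (φ : (⨂[𝕜] i, X i) ⊗[𝕜] Y →ₗ[𝕜] 𝕜)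
    (h : IsProjectivelyBdd φ) (u : (⨂[𝕜] i, X i) ⊗[𝕜] Y) :
    canonicalExtension φ h (bidualInclusion 𝕜 X Y u) = φ u := by
  suffices canonicalExtension φ h ∘ₗ bidualInclusion 𝕜 X Y = φ from LinearMap.congr_fun this u
  ext x y
  simp [bidualInclusion, canonicalExtension_tmul, associatedOperator_apply]

theorem norm_canonicalExtension_lTensor_le (φ : (⨂[𝕜] i, X i) ⊗[𝕜] Y →ₗ[𝕜] 𝕜)
    (h : IsProjectivelyBdd φ) {F : Type*} [NormedAddCommGroup F] [NormedSpace 𝕜 F]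
    [FiniteDimensional 𝕜 F] (u : (⨂[𝕜] i, X i) ⊗[𝕜] F) {C : ℝ} (hC : 0 ≤ C)
    (hu : ∀ S : F →L[𝕜] Y, ‖φ (S.toLinearMap.lTensor _ u)‖ ≤ C * ‖S‖)
    (T : F →L[𝕜] StrongDual 𝕜 (StrongDual 𝕜 Y)) :
    ‖canonicalExtension φ h (T.toLinearMap.lTensor _ u)‖ ≤ C * ‖T‖ := by
  obtain ⟨k, p, z, rfl⟩ := TensorProduct.exists_sum_tmul_eq u
  let L := PiTensorProduct.lift (associatedOperator φ h).toMultilinearMap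
  have hφ : ∀ S : F →L[𝕜] Y, φ (S.toLinearMap.lTensor _ (∑ j, p j ⊗ₜ[𝕜] z j)) =
      ∑ j, L (p j) (S (z j)) := fun S => by simp [L, lift_associatedOperator_apply]
  have hφ_ext : canonicalExtension φ h (T.toLinearMap.lTensor _ (∑ j, p j ⊗ₜ[𝕜] z j)) =
      ∑ j, T (z j) (L (p j)) := by simp [L, canonicalExtension]
  rw [hφ_ext]
  exact norm_sum_bidual_apply_le z (fun j => L (p j)) hC (fun S => hφ S ▸ hu S) T

end Tensor

namespace SigmaTensorNorm

variable {𝕜 : Type} [RCLike 𝕜] (α : SigmaTensorNorm.{u} 𝕜) {n : ℕ} [NeZero n]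
  {X : Fin n → Type u} [∀ i, NormedAddCommGroup (X i)] [∀ i, NormedSpace 𝕜 (X i)]
  {Y : Type u} [NormedAddCommGroup Y] [NormedSpace 𝕜 Y] [CompleteSpace Y]
  {W : Type u} [NormedAddCommGroup W] [NormedSpace 𝕜 W] [CompleteSpace W]
  (β : ReasonableCrossnorm 𝕜 X)

section Banach

variable [∀ i, CompleteSpace (X i)]

theorem norm_tprod_tmul_le (x : ∀ i, X i) (y : Y) :
    α.norm X Y β ((⨂ₜ[𝕜] i, x i) ⊗ₜ[𝕜] y) ≤ (∏ i, ‖x i‖) * ‖y‖ := by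
  have hS1 := α.norm_sub_tmul_le X Y β _ 0 ⟨x, rfl⟩ zero_mem_decomposable y
  rw [sub_zero] at hS1
  exact hS1.trans (mul_le_mul_of_nonneg_right (β.tprod_le x) (norm_nonneg y))

theorem norm_le_projectiveNorm (u : (⨂[𝕜] i, X i) ⊗[𝕜] Y) :
    α.norm X Y β u ≤ projectiveNorm u := by
  refine le_csInf (projectiveSums_nonempty u) ?_
  rintro _ ⟨k, x, y, rfl, rfl⟩
  exact (Finset.le_sum_of_subadditive _ (map_zero _).le (map_add_le_add _) _ _).trans
    (Finset.sum_le_sum fun j _ => α.norm_tprod_tmul_le β (x j) (y j))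

variable {β} in
theorem isProjectivelyBdd_of_isBdd {φ : (⨂[𝕜] i, X i) ⊗[𝕜] Y →ₗ[𝕜] 𝕜}
    (hφ : IsBdd (α.norm X Y β) (fun c : 𝕜 => ‖c‖) φ) : IsProjectivelyBdd φ := by
  obtain ⟨C, hC, hCφ⟩ := hφ.exists_nonneg (apply_nonneg _)
  exact ⟨C, fun u => (hCφ u).trans
    (mul_le_mul_of_nonneg_left (α.norm_le_projectiveNorm β u) hC)⟩

theorem norm_map_lift_le {m : ℕ} [NeZero m] {Z : Fin m → Type u}
    [∀ i, NormedAddCommGroup (Z i)] [∀ i, NormedSpace 𝕜 (Z i)] [∀ i, CompleteSpace (Z i)]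
    (θ : ReasonableCrossnorm 𝕜 Z) {R : MultilinearMap 𝕜 Z (⨂[𝕜] i, X i)}
    (hR : ∀ z, R z ∈ decomposable 𝕜 X) {C : ℝ} (hC : 0 ≤ C)
    (hRC : ∀ p, β (PiTensorProduct.lift R p) ≤ C * θ p) (S : W →L[𝕜] Y)
    (u : (⨂[𝕜] i, Z i) ⊗[𝕜] W) :
    α.norm X Y β (TensorProduct.map (PiTensorProduct.lift R) S.toLinearMap u) ≤
      C * ‖S‖ * α.norm Z W θ u := by
  obtain ⟨hbdd, hnorm⟩ := α.map_bound X Y β Z W θ R ⟨hR, C, hRC⟩ S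
  exact (hbdd.le_opNorm (apply_nonneg _) u).trans <| mul_le_mul_of_nonneg_right
    (hnorm.trans (mul_le_mul_of_nonneg_right (opNorm_le hC hRC) (norm_nonneg S)))
    (apply_nonneg _ _)

theorem norm_map_inclusion_le (E : ∀ i, Submodule 𝕜 (X i)) [∀ i, CompleteSpace (E i)]
    (S : W →L[𝕜] Y) (u : (⨂[𝕜] i, E i) ⊗[𝕜] W) :
    α.norm X Y β (TensorProduct.map (inclusion E) S.toLinearMap u) ≤
      ‖S‖ * α.norm (fun i => E i) W (β.restrict E) u := by
  have hS3 := α.norm_map_lift_le β (β.restrict E)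
    (R := (PiTensorProduct.tprod 𝕜).compLinearMap fun i => (E i).subtype)
    (fun x => ⟨fun i => x i, rfl⟩) zero_le_one
    (fun p => by rw [lift_tprod_compLinearMap_subtype, one_mul]; rfl) S u
  rwa [lift_tprod_compLinearMap_subtype, one_mul] at hS3

theorem norm_lTensor_le (S : W →L[𝕜] Y) (u : (⨂[𝕜] i, X i) ⊗[𝕜] W) :
    α.norm X Y β (S.toLinearMap.lTensor _ u) ≤ ‖S‖ * α.norm X W β u := by
  have hS3 := α.norm_map_lift_le β β (R := PiTensorProduct.tprod 𝕜) (fun x => ⟨x, rfl⟩)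
    zero_le_one (fun p => by simp [PiTensorProduct.lift_tprod]) S u
  rwa [PiTensorProduct.lift_tprod, one_mul] at hS3

theorem norm_bidualInclusion_le (u : (⨂[𝕜] i, X i) ⊗[𝕜] Y) :
    α.norm X (StrongDual 𝕜 (StrongDual 𝕜 Y)) β (bidualInclusion 𝕜 X Y u) ≤ α.norm X Y β u :=
  (α.norm_lTensor_le β (NormedSpace.inclusionInDoubleDual 𝕜 Y) u).trans <|
    mul_le_of_le_one_left (apply_nonneg _ _) (NormedSpace.inclusionInDoubleDual_norm_le 𝕜 Y)

theorem isClosed_range_lTensor {V : Type*} [AddCommGroup V] [Module 𝕜 V] (K : V →ₗ[𝕜] Y)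
    (hK : IsClosed (LinearMap.range K : Set Y)) :
    IsClosed[normTopology (α.norm X Y β)] (Set.range (K.lTensor (⨂[𝕜] i, X i))) := by
  have : IsClosed (LinearMap.range K : Set Y) := hK
  let Q := (LinearMap.range K).mkQL
  have hexact : Function.Exact (K.lTensor (⨂[𝕜] i, X i)) (Q.toLinearMap.lTensor _) :=
    lTensor_exact _ (LinearMap.exact_map_mkQ_range K) (Submodule.mkQ_surjective _)
  have hker := isClosed_ker_of_isBdd (α.eq_zero_of_norm_eq_zero X (Y ⧸ LinearMap.range K) β)
    ⟨‖Q‖, α.norm_lTensor_le β Q⟩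
  rwa [hexact.linearMap_ker_eq] at hker

theorem isClosed_range_bidualInclusion :
    IsClosed[normTopology (α.norm X (StrongDual 𝕜 (StrongDual 𝕜 Y)) β)]
      (Set.range (bidualInclusion 𝕜 X Y)) :=
  α.isClosed_range_lTensor β _
    (NormedSpace.inclusionInDoubleDualLi 𝕜 (E := Y)).isometry.isClosedEmbedding.isClosed_range

end Banach

section FinitelyGenerated

variable {α} [∀ i, CompleteSpace (X i)]

theorem FinitelyGenerated.norm_canonicalExtension_le (hα : α.FinitelyGenerated)
    {φ : (⨂[𝕜] i, X i) ⊗[𝕜] Y →ₗ[𝕜] 𝕜} (h : IsProjectivelyBdd φ) {C : ℝ} (hC : 0 ≤ C)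
    (hφ : ∀ u, ‖φ u‖ ≤ C * α.norm X Y β u)
    (u : (⨂[𝕜] i, X i) ⊗[𝕜] StrongDual 𝕜 (StrongDual 𝕜 Y)) :
    ‖canonicalExtension φ h u‖ ≤ C * α.norm X (StrongDual 𝕜 (StrongDual 𝕜 Y)) β u := by
  refine ((hα X (StrongDual 𝕜 (StrongDual 𝕜 Y)) β u).mul_left hC).2 ?_
  rintro _ ⟨_, ⟨E, F, _, _, v, rfl, rfl⟩, rfl⟩
  have : ∀ i, CompleteSpace (E i) := fun i => FiniteDimensional.complete 𝕜 (E i)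
  have : CompleteSpace F := FiniteDimensional.complete 𝕜 F
  have hS : ∀ S : F →L[𝕜] Y, ‖φ (S.toLinearMap.lTensor _ ((inclusion E).rTensor F v))‖ ≤
      C * α.restrictNorm β E F v * ‖S‖ := fun S =>
    calc ‖φ (S.toLinearMap.lTensor _ ((inclusion E).rTensor F v))‖
        = ‖φ (TensorProduct.map (inclusion E) S.toLinearMap v)‖ := by
          rw [← LinearMap.comp_apply (S.toLinearMap.lTensor _), LinearMap.lTensor_comp_rTensor]
      _ ≤ C * (‖S‖ * α.restrictNorm β E F v) :=
          (hφ _).trans (mul_le_mul_of_nonneg_left (α.norm_map_inclusion_le β E S v) hC)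
      _ = C * α.restrictNorm β E F v * ‖S‖ := by ring
  have hCv : 0 ≤ C * α.restrictNorm β E F v := mul_nonneg hC (apply_nonneg _ v)
  calc ‖canonicalExtension φ h (TensorProduct.map (inclusion E) F.subtype v)‖
      = ‖canonicalExtension φ h (F.subtypeL.toLinearMap.lTensor _
          ((inclusion E).rTensor F v))‖ := by
        rw [← LinearMap.comp_apply (F.subtypeL.toLinearMap.lTensor _),
          LinearMap.lTensor_comp_rTensor, Submodule.toLinearMap_subtypeL]
    _ ≤ C * α.restrictNorm β E F v * ‖F.subtypeL‖ :=
        norm_canonicalExtension_lTensor_le φ h _ hCv hS F.subtypeL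
    _ ≤ C * α.restrictNorm β E F v := mul_le_of_le_one_right hCv F.norm_subtypeL_le

theorem FinitelyGenerated.norm_bidualInclusion (hα : α.FinitelyGenerated)
    (u : (⨂[𝕜] i, X i) ⊗[𝕜] Y) :
    α.norm X (StrongDual 𝕜 (StrongDual 𝕜 Y)) β (bidualInclusion 𝕜 X Y u) =
      α.norm X Y β u := by
  refine (α.norm_bidualInclusion_le β u).antisymm ?_
  obtain ⟨g, hg, hgu⟩ := exists_functional_apply_eq (α.norm X Y β) u
  have hg_bound : ∀ w, ‖g w‖ ≤ 1 * α.norm X Y β w := fun w => (hg w).trans_eq (one_mul _).symm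
  have hg_proj := α.isProjectivelyBdd_of_isBdd ⟨1, hg_bound⟩
  calc α.norm X Y β u = ‖canonicalExtension g hg_proj (bidualInclusion 𝕜 X Y u)‖ := by
        rw [canonicalExtension_bidualInclusion, hgu]
    _ ≤ 1 * α.norm X (StrongDual 𝕜 (StrongDual 𝕜 Y)) β (bidualInclusion 𝕜 X Y u) :=
        hα.norm_canonicalExtension_le β hg_proj zero_le_one hg_bound _
    _ = _ := one_mul _

variable {β}

theorem FinitelyGenerated.norm_canonicalExtension_le_iff (hα : α.FinitelyGenerated)
    {φ : (⨂[𝕜] i, X i) ⊗[𝕜] Y →ₗ[𝕜] 𝕜} (h : IsProjectivelyBdd φ) {C : ℝ} (hC : 0 ≤ C) :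
    (∀ u, ‖canonicalExtension φ h u‖ ≤ C * α.norm X (StrongDual 𝕜 (StrongDual 𝕜 Y)) β u) ↔
      ∀ u, ‖φ u‖ ≤ C * α.norm X Y β u := by
  refine ⟨fun hφ_ext u => ?_, hα.norm_canonicalExtension_le β h hC⟩
  rw [← canonicalExtension_bidualInclusion φ h u]
  exact (hφ_ext _).trans (mul_le_mul_of_nonneg_left (α.norm_bidualInclusion_le β u) hC)

theorem FinitelyGenerated.isBdd_canonicalExtension_iff (hα : α.FinitelyGenerated)
    {φ : (⨂[𝕜] i, X i) ⊗[𝕜] Y →ₗ[𝕜] 𝕜} (h : IsProjectivelyBdd φ) :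
    IsBdd (α.norm X (StrongDual 𝕜 (StrongDual 𝕜 Y)) β) (fun c : 𝕜 => ‖c‖)
      (canonicalExtension φ h) ↔ IsBdd (α.norm X Y β) (fun c : 𝕜 => ‖c‖) φ := by
  constructor <;> intro hbdd <;> obtain ⟨C, hC, hbound⟩ := hbdd.exists_nonneg (apply_nonneg _)
  · exact ⟨C, (hα.norm_canonicalExtension_le_iff h hC).1 hbound⟩
  · exact ⟨C, (hα.norm_canonicalExtension_le_iff h hC).2 hbound⟩

theorem FinitelyGenerated.opNorm_canonicalExtension (hα : α.FinitelyGenerated)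
    {φ : (⨂[𝕜] i, X i) ⊗[𝕜] Y →ₗ[𝕜] 𝕜} (h : IsProjectivelyBdd φ) :
    opNorm (α.norm X (StrongDual 𝕜 (StrongDual 𝕜 Y)) β) (fun c : 𝕜 => ‖c‖)
      (canonicalExtension φ h) = opNorm (α.norm X Y β) (fun c : 𝕜 => ‖c‖) φ :=
  congrArg sInf <| Set.ext fun _ => and_congr_right (hα.norm_canonicalExtension_le_iff h)

end FinitelyGenerated

end SigmaTensorNorm

end SigmaTensor

theorem mainTheorem5 {𝕜 : Type} [RCLike 𝕜]
    (α : SigmaTensor.SigmaTensorNorm.{u} 𝕜) (hα : α.FinitelyGenerated)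
    {n : ℕ} [NeZero n] (X : Fin n → Type u) [∀ i, NormedAddCommGroup (X i)]
    [∀ i, NormedSpace 𝕜 (X i)] [∀ i, CompleteSpace (X i)]
    (Y : Type u) [NormedAddCommGroup Y] [NormedSpace 𝕜 Y] [CompleteSpace Y]
    (β : SigmaTensor.ReasonableCrossnorm 𝕜 X) :
    -- (i) `I ⊗ K_Y` is an isometric embedding with closed range
    ((∀ u : (⨂[𝕜] i, X i) ⊗[𝕜] Y,
        α.norm X (StrongDual 𝕜 (StrongDual 𝕜 Y)) β (SigmaTensor.bidualInclusion 𝕜 X Y u) =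
          α.norm X Y β u) ∧
      IsClosed[SigmaTensor.normTopology (α.norm X (StrongDual 𝕜 (StrongDual 𝕜 Y)) β)]
        (Set.range (SigmaTensor.bidualInclusion 𝕜 X Y))) ∧
    -- (ii) `φ` is `α^β`-bounded iff its canonical extension is defined and `α^β`-bounded
    (∀ φ : (⨂[𝕜] i, X i) ⊗[𝕜] Y →ₗ[𝕜] 𝕜,
      (SigmaTensor.IsBdd (α.norm X Y β) (fun c : 𝕜 => ‖c‖) φ ↔
        ∃ h : SigmaTensor.IsProjectivelyBdd φ,
          SigmaTensor.IsBdd (α.norm X (StrongDual 𝕜 (StrongDual 𝕜 Y)) β) (fun c : 𝕜 => ‖c‖)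
            (SigmaTensor.canonicalExtension φ h)) ∧
      (SigmaTensor.IsBdd (α.norm X Y β) (fun c : 𝕜 => ‖c‖) φ →
        ∀ h : SigmaTensor.IsProjectivelyBdd φ,
          SigmaTensor.opNorm (α.norm X Y β) (fun c : 𝕜 => ‖c‖) φ =
            SigmaTensor.opNorm (α.norm X (StrongDual 𝕜 (StrongDual 𝕜 Y)) β)
              (fun c : 𝕜 => ‖c‖) (SigmaTensor.canonicalExtension φ h))) := by
  refine ⟨⟨hα.norm_bidualInclusion β, α.isClosed_range_bidualInclusion β⟩, fun φ =>
    ⟨⟨fun hφ => ?_, ?_⟩, fun _ h => (hα.opNorm_canonicalExtension h).symm⟩⟩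
  · have h := α.isProjectivelyBdd_of_isBdd hφ
    exact ⟨h, (hα.isBdd_canonicalExtension_iff h).2 hφ⟩
  · rintro ⟨h, hφ_ext⟩
    exact (hα.isBdd_canonicalExtension_iff h).1 hφ_ext
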